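/- A $\mathbb{Z}^2$-topological dynamical system $(X,T)$ is a compact metric space $X$ with an action $g\mapsto T^{g}$ of $\mathbb{Z}^2$ on $X$ by homeomorphisms; $M(X,T)$ is the set of $T$-invariant Borel probability measures on $X$, and $\mathcal{B}_X$ is the Borel $\sigma$-algebra of $X$. Fix a direction $\vec v=(1,\beta)$ with $\beta\in\mathbb{R}$. For $b>0$ put $$\Lambda^{\vec v}(b)=\{(m,n)\in\mathbb{Z}^2:\ \beta m-b/2\le n\le \beta m+b/2\}.$$ For a probability measure $\mu$ invariant under a $\mathbb{Z}^2$-action $T$ on $(X,\mathcal{B})$, let $$\mathcal{K}^{\vec v}_\mu(b)=\left\{B\in\mathcal{B}:\ \overline{\{1_B\circ T^{(m,n)}:(m,n)\in\Lambda^{\vec v}(b)\}}\ \text{is compact in } L^2(X,\mathcal{B},\mu)\right\}$$ be the $\vec v$-directional Kronecker algebra computed with the width $b$. The system $(X,\mathcal{B},\mu,T)$ is called $\vec v$-weak mixing (with respect to $b$) if $\mathcal{K}^{\vec v}_\mu(b)=\{X,\emptyset\}$ modulo $\mu$-null sets, that is, every $B\in\mathcal{K}^{\vec v}_\mu(b)$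 satisfies $\mu(B)\in\{0,1\}$. **Theorem.** Let $(X_1,T_1)$ and $(X_2,T_2)$ be two $\mathbb{Z}^2$-topological dynamical systems, let $\mu\in M(X_1,T_1)$, $\nu\in M(X_2,T_2)$, and let $\vec v=(1,\beta)\in\mathbb{R}^2$. If $(X_1,\mathcal{B}_{X_1},\mu,T_1)$ and $(X_2,\mathcal{B}_{X_2},\nu,T_2)$ are $\vec v$-weak mixing, then so is the product system $(X_1\times X_2,\mathcal{B}_{X_1}\times\mathcal{B}_{X_2},\mu\times\nu,T_1\times T_2)$, where $(T_1\times T_2)^{g}=T_1^{g}\times T_2^{g}$ for $g\in\mathbb{Z}^2$. This holds for every choice of the widths: if $\mathcal{K}^{\vec v}_\mu(b_1)$ and $\mathcal{K}^{\vec v}_\nu(b_2)$ are trivial modulo null sets for some $b_1,b_2>0$, then $\mathcal{K}^{\vec v}_{\mu\times\nu}(b)$ is trivial modulo null sets for every $b>0$. -/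

import Mathlib

open MeasureTheory

namespace DirectionalMixing

/-- The strip `Λ(b)` of width `b` in `ℤ²` around the line spanned by `(1, β)`. -/
def strip (β b : ℝ) : Set (ℤ × ℤ) :=
  {p | β * (p.1 : ℝ) - b / 2 ≤ (p.2 : ℝ) ∧ (p.2 : ℝ) ≤ β * (p.1 : ℝ) + b / 2}

section Systems

variable {X : Type*} [MeasurableSpace X] [AddAction (ℤ × ℤ) X] [MeasurableConstVAdd (ℤ × ℤ) X]

/-- The Koopman operator `f ↦ f ∘ T^g` on the complex space `L²(μ)`, where `T^g x = g +ᵥ x`. -/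
noncomputable def koopman (μ : Measure X) [VAddInvariantMeasure (ℤ × ℤ) X μ] (g : ℤ × ℤ) :
    Lp ℂ 2 μ →ₗᵢ[ℂ] Lp ℂ 2 μ :=
  Lp.compMeasurePreservingₗᵢ ℂ (fun x : X => g +ᵥ x) (measurePreserving_vadd g μ)

/-- The directional Kronecker algebra in direction `(1, β)`, computed with the strip of width `b`:
the measurable sets `B` such that the orbit of `1_B` along the strip has compact closure in `L²`. -/
def kroneckerAlgebra (μ : Measure X) [IsProbabilityMeasure μ]
    [VAddInvariantMeasure (ℤ × ℤ) X μ] (β b : ℝ) : Set (Set X) :=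
  {B | ∃ hB : MeasurableSet B,
    IsCompact (closure ((fun g : ℤ × ℤ =>
      koopman μ g (indicatorConstLp 2 hB (measure_ne_top μ B) (1 : ℂ))) '' strip β b))}

/-- The system is weakly mixing in direction `(1, β)` (with the strip of width `b`): its directional
Kronecker algebra consists, up to null sets, of the empty set and the whole space only. -/
def IsWeakMixing (μ : Measure X) [IsProbabilityMeasure μ]
    [VAddInvariantMeasure (ℤ × ℤ) X μ] (β b : ℝ) : Prop :=
  ∀ B ∈ kroneckerAlgebra μ β b, B =ᵐ[μ] (∅ : Set X) ∨ B =ᵐ[μ] (Set.univ : Set X)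

end Systems

section Product

variable {X Y : Type*} [MeasurableSpace X] [AddAction (ℤ × ℤ) X] [MeasurableConstVAdd (ℤ × ℤ) X]
  [MeasurableSpace Y] [AddAction (ℤ × ℤ) Y] [MeasurableConstVAdd (ℤ × ℤ) Y]

/-- The product action `g +ᵥ (x, y) = (g +ᵥ x, g +ᵥ y)` is measurable. -/
instance instMeasurableConstVAddProd : MeasurableConstVAdd (ℤ × ℤ) (X × Y) where
  measurable_const_vadd g :=
    ((measurable_const_vadd g).comp measurable_fst).prodMk
      ((measurable_const_vadd g).comp measurable_snd)

/-- The product measure is invariant under the product action. -/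
instance instVAddInvariantMeasureProd (μ : Measure X) (ν : Measure Y)
    [IsProbabilityMeasure μ] [IsProbabilityMeasure ν]
    [VAddInvariantMeasure (ℤ × ℤ) X μ] [VAddInvariantMeasure (ℤ × ℤ) Y ν] :
    VAddInvariantMeasure (ℤ × ℤ) (X × Y) (μ.prod ν) where
  measure_preimage_vadd g _ hs :=
    ((measurePreserving_vadd g μ).prod (measurePreserving_vadd g ν)).measure_preimage
      hs.nullMeasurableSet

end Product

end DirectionalMixing

/-!
Let `B` be a set whose indicator is almost periodic along a strip for the product system. For
measurable `C ⊆ Y`, the partial integral `x ↦ ∫_C 1_B(x, y) dν(y)` is almost periodic for the first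
system: its translate by `g` is the partial integral over `g⁻¹C` of the translate of `1_B`, and for
each `Φ ∈ L²(μ × ν)` the partial integrals `∫_E Φ(·, y) dν(y)`, over all measurable `E`, form a
precompact family, as a kernel in `L²(μ × ν)` defines a Hilbert–Schmidt, hence compact, operator.
Weak mixing makes almost periodic functions constant, because indicators of preimages of closed
sets under an almost periodic function are almost periodic. So the partial integrals are constant;
together with the same fact for the second factor this makes `B` independent of every measurable
rectangle, hence of itself.
-/

open Filter ProbabilityTheory
open scoped ENNReal Pointwise Topology

namespace DirectionalMixing

section TotallyBounded

variable {ι α γ : Type*} [PseudoMetricSpace α] [PseudoMetricSpace γ]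

theorem isCompact_closure_iff_totallyBounded {β : Type*} [UniformSpace β] [CompleteSpace β]
    {s : Set β} :
    IsCompact (closure s) ↔ TotallyBounded s :=
  ⟨fun h => h.totallyBounded.subset subset_closure,
    fun h => h.closure.isCompact_of_isClosed isClosed_closure⟩

theorem totallyBounded_of_forall_subset_thickening {s : Set α}
    (h : ∀ ε > 0, ∃ t : Set α, TotallyBounded t ∧ s ⊆ Metric.thickening ε t) :
    TotallyBounded s := by
  refine Metric.totallyBounded_iff.2 fun ε hε => ?_
  obtain ⟨t, ht, hst⟩ := h (ε / 2) (half_pos hε)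
  obtain ⟨N, hN, htN⟩ := Metric.totallyBounded_iff.1 ht (ε / 2) (half_pos hε)
  refine ⟨N, hN, fun x hx => ?_⟩
  obtain ⟨y, hyt, hxy⟩ := Metric.mem_thickening_iff.1 (hst hx)
  obtain ⟨z, hzN, hyz⟩ := Set.mem_iUnion₂.1 (htN hyt)
  exact Set.mem_biUnion hzN <| by
    simpa using (dist_triangle x y z).trans_lt (add_lt_add hxy hyz)

theorem totallyBounded_image2 {f : ι → α → γ} {S : Set ι} {K : Set α}
    (hf : UniformEquicontinuous f) (hK : TotallyBounded K)
    (hS : ∀ x ∈ K, TotallyBounded ((f · x) '' S)) :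
    TotallyBounded (Set.image2 f S K) := by
  refine totallyBounded_of_forall_subset_thickening fun ε hε => ?_
  obtain ⟨δ, hδ, hfδ⟩ := Metric.uniformEquicontinuous_iff.1 hf ε hε
  obtain ⟨N, hNK, hN, hKN⟩ := Metric.finite_approx_of_totallyBounded hK δ hδ
  refine ⟨⋃ x ∈ N, (f · x) '' S, (totallyBounded_biUnion hN).2 fun x hx => hS x (hNK hx), ?_⟩
  rintro _ ⟨i, hi, x, hx, rfl⟩
  obtain ⟨z, hzN, hxz⟩ := Set.mem_iUnion₂.1 (hKN hx)
  exact Metric.mem_thickening_iff.2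
    ⟨f i z, Set.mem_biUnion hzN (Set.mem_image_of_mem _ hi), hfδ x z hxz i⟩

theorem totallyBounded_add {E : Type*} [SeminormedAddCommGroup E] {s t : Set E}
    (hs : TotallyBounded s) (ht : TotallyBounded t) : TotallyBounded (s + t) :=
  totallyBounded_image2
    (LipschitzWith.uniformEquicontinuous _ 1 fun x => (isometry_add_left x).lipschitz) ht
    fun y _ => hs.image (isometry_add_right y).uniformContinuous

end TotallyBounded

section PrecompactOrbits

variable {ι 𝕜 E F : Type*} [NormedField 𝕜]
  [SeminormedAddCommGroup E] [NormedSpace 𝕜 E] [SeminormedAddCommGroup F] [NormedSpace 𝕜 F]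

/-- The vectors whose orbit under the operators `R i`, `i ∈ S`, is precompact. Precompactness is
expressed by total boundedness, which agrees with compactness of the closure if `F` is complete. -/
def precompactOrbitSubmodule (R : ι → E →L[𝕜] F) (S : Set ι) : Submodule 𝕜 E where
  carrier := {x | TotallyBounded ((fun i => R i x) '' S)}
  zero_mem' := by
    refine (totallyBounded_singleton (0 : F)).subset ?_
    rintro _ ⟨i, -, rfl⟩
    exact map_zero (R i)
  add_mem' {x y} hx hy := by
    refine (totallyBounded_add hx hy).subset ?_
    rintro _ ⟨i, hi, rfl⟩
    exact ⟨R i x, ⟨i, hi, rfl⟩, R i y, ⟨i, hi, rfl⟩, (map_add (R i) x y).symm⟩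
  smul_mem' c x hx := by
    refine (TotallyBounded.image hx (uniformContinuous_const_smul c)).subset ?_
    rintro _ ⟨i, hi, rfl⟩
    exact ⟨R i x, ⟨i, hi, rfl⟩, (map_smul (R i) c x).symm⟩

theorem mem_precompactOrbitSubmodule {R : ι → E →L[𝕜] F} {S : Set ι} {x : E} :
    x ∈ precompactOrbitSubmodule R S ↔ TotallyBounded ((fun i => R i x) '' S) :=
  Iff.rfl

theorem isClosed_precompactOrbitSubmodule {R : ι → E →L[𝕜] F}
    (hR : UniformEquicontinuous fun i => ⇑(R i)) (S : Set ι) :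
    IsClosed (precompactOrbitSubmodule R S : Set E) := by
  refine isClosed_of_closure_subset fun x hx => totallyBounded_of_forall_subset_thickening
    fun ε hε => ?_
  obtain ⟨δ, hδ, hRδ⟩ := Metric.uniformEquicontinuous_iff.1 hR ε hε
  obtain ⟨y, hy, hxy⟩ := Metric.mem_closure_iff.1 hx δ hδ
  refine ⟨_, hy, ?_⟩
  rintro _ ⟨i, hi, rfl⟩
  exact Metric.mem_thickening_iff.2 ⟨R i y, ⟨i, hi, rfl⟩, hRδ x y hxy i⟩

end PrecompactOrbits

section PiSystem

variable {Ω : Type*} [m : MeasurableSpace Ω] {P : Measure Ω} {π : Set (Set Ω)}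

theorem setIntegral_eq_zero_of_isPiSystem {E : Type*} [NormedAddCommGroup E] [NormedSpace ℝ E]
    {f : Ω → E} (hf : Integrable f P)
    (hgen : m = MeasurableSpace.generateFrom π) (hπ : IsPiSystem π) (huniv : Set.univ ∈ π)
    (h : ∀ A ∈ π, ∫ x in A, f x ∂P = 0) {A : Set Ω} (hA : MeasurableSet A) :
    ∫ x in A, f x ∂P = 0 := by
  induction A, hA using MeasurableSpace.induction_on_inter hgen hπ with
  | empty => simp
  | basic A hA => exact h A hA
  | compl A hA ih => rw [setIntegral_compl hA hf, ih, ← setIntegral_univ, h _ huniv, sub_zero]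
  | iUnion A hdisj hA ih =>
    rw [integral_iUnion hA hdisj hf.integrableOn]
    simp only [ih, tsum_zero]

variable [IsFiniteMeasure P]

/-- The class of the indicator function of a measurable set in the complex space `L²(P)`. -/
noncomputable abbrev indicatorL2 (P : Measure Ω) [IsFiniteMeasure P] {A : Set Ω}
    (hA : MeasurableSet A) : Lp ℂ 2 P :=
  indicatorConstLp 2 hA (measure_ne_top P A) 1

variable (P) in
theorem coeFn_indicatorL2 {A : Set Ω} (hA : MeasurableSet A) :
    indicatorL2 P hA =ᵐ[P] A.indicator fun _ => 1 :=
  indicatorConstLp_coeFn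

theorem eq_top_of_indicatorL2_mem {V : Submodule ℂ (Lp ℂ 2 P)} (hV : IsClosed (V : Set (Lp ℂ 2 P)))
    (hgen : m = MeasurableSpace.generateFrom π) (hπ : IsPiSystem π) (huniv : Set.univ ∈ π)
    (hmem : ∀ A ∈ π, ∀ hA : MeasurableSet A, indicatorL2 P hA ∈ V) : V = ⊤ := by
  have := hV.completeSpace_coe
  refine V.orthogonal_eq_bot_iff.1 ((Submodule.eq_bot_iff _).2 fun f hf => ?_)
  have hint : Integrable f P := (Lp.memLp f).integrable one_le_two
  have hπ0 : ∀ A ∈ π, ∫ x in A, f x ∂P = 0 := fun A hA => by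
    have hAm : MeasurableSet A := hgen ▸ MeasurableSpace.measurableSet_generateFrom hA
    rw [← L2.inner_indicatorConstLp_one hAm (measure_ne_top P A)]
    exact hf _ (hmem A hA hAm)
  refine (Lp.eq_zero_iff_ae_eq_zero).2
    (hint.ae_eq_zero_of_forall_setIntegral_eq_zero fun A hA _ => ?_)
  exact setIntegral_eq_zero_of_isPiSystem hint hgen hπ huniv hπ0 hA

theorem ext_inner_indicatorL2 {f g : Lp ℂ 2 P}
    (h : ∀ {A : Set Ω} (hA : MeasurableSet A),
      inner ℂ (indicatorL2 P hA) f = inner ℂ (indicatorL2 P hA) g) : f = g := by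
  have hint : ∀ u : Lp ℂ 2 P, Integrable u P := fun u => (Lp.memLp u).integrable one_le_two
  refine Lp.ext ((hint f).ae_eq_of_forall_setIntegral_eq _ _ (hint g) fun A hA _ => ?_)
  simpa only [L2.inner_indicatorConstLp_one] using h hA

end PiSystem

section ZeroOne

variable {Ω : Type*} [m : MeasurableSpace Ω] {P : Measure Ω} [IsProbabilityMeasure P]
  {π : Set (Set Ω)} {B : Set Ω}

theorem ae_eq_empty_or_univ_of_indepSets (hgen : m = MeasurableSpace.generateFrom π)
    (hπ : IsPiSystem π) (hB : MeasurableSet B) (h : IndepSets π {B} P) :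
    B =ᵐ[P] (∅ : Set Ω) ∨ B =ᵐ[P] (Set.univ : Set Ω) := by
  have hindep : Indep m (MeasurableSpace.generateFrom {B}) P :=
    h.indep le_rfl (MeasurableSpace.generateFrom_singleton_le hB) hπ (IsPiSystem.singleton B)
      hgen rfl
  have hself : IndepSet B B P := hindep.indepSet_of_measurableSet hB
    (MeasurableSpace.measurableSet_generateFrom (Set.mem_singleton B))
  exact (measure_eq_zero_or_one_of_indepSet_self hself).imp ae_eq_empty.2
    fun hone => ae_eq_univ.2 ((prob_compl_eq_zero_iff hB).2 hone)

end ZeroOne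

section Thickening

variable {Ω Z : Type*} [MeasurableSpace Ω] [PseudoEMetricSpace Z] [MeasurableSpace Z]
  [OpensMeasurableSpace Z] {P : Measure Ω} [IsFiniteMeasure P] {f : Ω → Z} {F : Set Z}

theorem tendsto_indicatorL2_preimage_thickening (hf : Measurable f) (hF : IsClosed F) :
    Tendsto (fun δ => indicatorL2 P (hf (Metric.isOpen_thickening (δ := δ) (E := F)).measurableSet))
      (𝓝[>] 0) (𝓝 (indicatorL2 P (hf hF.measurableSet))) := by
  refine tendsto_indicatorConstLp_set ENNReal.ofNat_ne_top ?_
  have hlim := tendsto_measure_thickening_of_isClosed (μ := P.map f)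
    ⟨1, one_pos, measure_ne_top _ _⟩ hF
  rw [Measure.map_apply hf hF.measurableSet] at hlim
  have hdiff := ENNReal.Tendsto.sub hlim (tendsto_const_nhds (x := P (f ⁻¹' F)))
    (Or.inr (measure_ne_top P _))
  rw [tsub_self] at hdiff
  refine hdiff.congr' (eventually_mem_nhdsWithin.mono fun δ hδ => ?_)
  have hsub : f ⁻¹' F ⊆ f ⁻¹' Metric.thickening δ F :=
    Set.preimage_mono (Metric.self_subset_thickening hδ F)
  simp only [Measure.map_apply hf Metric.isOpen_thickening.measurableSet, symmDiff_of_ge hsub,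
    measure_sdiff hsub (hf hF.measurableSet).nullMeasurableSet (measure_ne_top P _)]

theorem norm_sub_indicatorL2_preimage_le (hf : Measurable f) (hF : IsClosed F) {δ : ℝ} (hδ : 0 < δ)
    {u : Lp ℂ 2 P} (hu : u =ᵐ[P] fun x => ((thickenedIndicator hδ F (f x) : ℝ) : ℂ)) :
    ‖u - indicatorL2 P (hf hF.measurableSet)‖ ≤
      ‖indicatorL2 P (hf (Metric.isOpen_thickening (δ := δ) (E := F)).measurableSet) -
        indicatorL2 P (hf hF.measurableSet)‖ := by
  have hFm := hf hF.measurableSet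
  have hδm := hf (Metric.isOpen_thickening (δ := δ) (E := F)).measurableSet
  refine Lp.norm_le_norm_of_ae_le ?_
  filter_upwards [hu, Lp.coeFn_sub u (indicatorL2 P hFm),
    Lp.coeFn_sub (indicatorL2 P hδm) (indicatorL2 P hFm),
    coeFn_indicatorL2 P hFm, coeFn_indicatorL2 P hδm] with x hux h₁ h₂ h₃ h₄
  rw [h₁, h₂, Pi.sub_apply, Pi.sub_apply, hux, h₃, h₄]
  by_cases hxF : f x ∈ F
  · simp [hxF, thickenedIndicator_one hδ F hxF]
  by_cases hxδ : f x ∈ Metric.thickening δ F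
  · simpa [hxF, hxδ] using thickenedIndicator_le_one hδ F (f x)
  · simp [hxF, hxδ, thickenedIndicator_zero hδ F hxδ]

end Thickening

section AlmostPeriodic

variable {X : Type*} [MeasurableSpace X] [AddAction (ℤ × ℤ) X] [MeasurableConstVAdd (ℤ × ℤ) X]
  {μ : Measure X}

section

variable [VAddInvariantMeasure (ℤ × ℤ) X μ] {S S' : Set (ℤ × ℤ)} {f : Lp ℂ 2 μ}

theorem coeFn_koopman (g : ℤ × ℤ) (f : Lp ℂ 2 μ) : koopman μ g f =ᵐ[μ] fun x => f (g +ᵥ x) :=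
  Lp.coeFn_compMeasurePreserving f (measurePreserving_vadd g μ)

theorem koopman_indicatorL2 [IsFiniteMeasure μ] (g : ℤ × ℤ) {A : Set X} (hA : MeasurableSet A) :
    koopman μ g (indicatorL2 μ hA) = indicatorL2 μ (measurable_const_vadd g hA) :=
  rfl

theorem koopman_add (g h : ℤ × ℤ) (f : Lp ℂ 2 μ) :
    koopman μ (g + h) f = koopman μ g (koopman μ h f) := by
  refine Lp.ext ?_
  filter_upwards [coeFn_koopman (g + h) f, coeFn_koopman g (koopman μ h f),
    (measurePreserving_vadd g μ).quasiMeasurePreserving.ae (coeFn_koopman h f)] with x h₁ h₂ h₃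
  rw [h₁, h₂, h₃, add_comm g h, add_vadd]

/-- The functions in `L²(μ)` that are almost periodic along `S ⊆ ℤ²`: those whose translates by the
elements of `S` form a precompact family. -/
noncomputable def almostPeriodic (μ : Measure X) [VAddInvariantMeasure (ℤ × ℤ) X μ]
    (S : Set (ℤ × ℤ)) : Submodule ℂ (Lp ℂ 2 μ) :=
  precompactOrbitSubmodule (fun g => (koopman μ g).toContinuousLinearMap) S

theorem mem_almostPeriodic :
    f ∈ almostPeriodic μ S ↔ TotallyBounded ((fun g => koopman μ g f) '' S) :=
  Iff.rfl

theorem isClosed_almostPeriodic : IsClosed (almostPeriodic μ S : Set (Lp ℂ 2 μ)) :=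
  isClosed_precompactOrbitSubmodule
    (LipschitzWith.uniformEquicontinuous _ 1 fun g => (koopman μ g).lipschitz) S

theorem almostPeriodic_le_of_subset_add {N : Set (ℤ × ℤ)} (hN : N.Finite) (h : S' ⊆ N + S) :
    almostPeriodic μ S ≤ almostPeriodic μ S' := by
  intro f hf
  refine TotallyBounded.subset ?_ ((totallyBounded_biUnion hN).2 fun k _ =>
    hf.image (koopman μ k).isometry.uniformContinuous)
  rintro _ ⟨_, hkg, rfl⟩
  obtain ⟨k, hk, g, hg, rfl⟩ := h hkg
  exact Set.mem_biUnion hk ⟨_, ⟨g, hg, rfl⟩, (koopman_add k g f).symm⟩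

theorem compLp_mem_almostPeriodic {C : NNReal} {φ : ℂ → ℂ} (hφ : LipschitzWith C φ) (hφ0 : φ 0 = 0)
    (hf : f ∈ almostPeriodic μ S) : hφ.compLp hφ0 f ∈ almostPeriodic μ S := by
  refine (hf.image (hφ.lipschitzWith_compLp hφ0).uniformContinuous).subset ?_
  rintro _ ⟨g, hg, rfl⟩
  refine ⟨_, ⟨g, hg, rfl⟩, Lp.ext ?_⟩
  filter_upwards [hφ.coeFn_compLp hφ0 (koopman μ g f), coeFn_koopman g f,
    coeFn_koopman g (hφ.compLp hφ0 f),
    (measurePreserving_vadd g μ).quasiMeasurePreserving.ae (hφ.coeFn_compLp hφ0 f)]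
    with x h₁ h₂ h₃ h₄
  exact h₁.trans (h₃.trans (h₄.trans (congrArg φ h₂.symm))).symm

end

variable [IsProbabilityMeasure μ] [VAddInvariantMeasure (ℤ × ℤ) X μ] {S : Set (ℤ × ℤ)}
  {f : Lp ℂ 2 μ} {β b b' : ℝ}

theorem mem_kroneckerAlgebra_iff {B : Set X} (hB : MeasurableSet B) :
    B ∈ kroneckerAlgebra μ β b ↔ indicatorL2 μ hB ∈ almostPeriodic μ (strip β b) := by
  rw [mem_almostPeriodic, ← isCompact_closure_iff_totallyBounded]
  exact ⟨fun h => h.2, fun h => ⟨hB, h⟩⟩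

theorem const_mem_almostPeriodic (c : ℂ) : Lp.const 2 μ c ∈ almostPeriodic μ S := by
  refine (totallyBounded_singleton (Lp.const 2 μ c)).subset ?_
  rintro _ ⟨g, -, rfl⟩
  exact Subtype.ext (AEEqFun.compMeasurePreserving_mk aestronglyMeasurable_const
    (measurePreserving_vadd g μ))

theorem exists_mem_almostPeriodic_comp {C : NNReal} {φ : ℂ → ℂ} (hφ : LipschitzWith C φ)
    (hf : f ∈ almostPeriodic μ S) : ∃ u ∈ almostPeriodic μ S, u =ᵐ[μ] φ ∘ f := by
  have hψ : LipschitzWith (C + 0) fun z => φ z - φ 0 := hφ.sub (LipschitzWith.const _)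
  have hψ0 : φ 0 - φ 0 = 0 := sub_self _
  refine ⟨_, add_mem (compLp_mem_almostPeriodic hψ hψ0 hf) (const_mem_almostPeriodic (φ 0)), ?_⟩
  filter_upwards [Lp.coeFn_add (hψ.compLp hψ0 f) (Lp.const 2 μ (φ 0)), hψ.coeFn_compLp hψ0 f,
    Lp.coeFn_const 2 μ (φ 0)] with x h₁ h₂ h₃
  rw [h₁, Pi.add_apply, h₂, h₃]
  exact sub_add_cancel _ _

theorem indicatorL2_preimage_mem_almostPeriodic (hf : f ∈ almostPeriodic μ S) {F : Set ℂ}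
    (hF : IsClosed F) :
    indicatorL2 μ ((Lp.stronglyMeasurable f).measurable hF.measurableSet) ∈
      almostPeriodic μ S := by
  have hfm := (Lp.stronglyMeasurable f).measurable
  rw [← SetLike.mem_coe, ← isClosed_almostPeriodic.closure_eq, Metric.mem_closure_iff]
  intro ε hε
  obtain ⟨δ, hdist, hδ : 0 < δ⟩ := ((Metric.tendsto_nhds.1
    (tendsto_indicatorL2_preimage_thickening (P := μ) hfm hF) ε hε).and
      eventually_mem_nhdsWithin).exists
  obtain ⟨u, hu, huf⟩ := exists_mem_almostPeriodic_comp (Complex.isometry_ofReal.lipschitz.comp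
    (isometry_subtype_coe.lipschitz.comp (lipschitzWith_thickenedIndicator hδ F))) hf
  refine ⟨u, hu, ?_⟩
  rw [dist_comm, dist_eq_norm]
  exact (norm_sub_indicatorL2_preimage_le hfm hF hδ huf).trans_lt (by rwa [← dist_eq_norm])

end AlmostPeriodic

section Strip

variable {X : Type*} [MeasurableSpace X] [AddAction (ℤ × ℤ) X] [MeasurableConstVAdd (ℤ × ℤ) X]
  {μ : Measure X} [VAddInvariantMeasure (ℤ × ℤ) X μ] {β b b' : ℝ}

theorem mem_strip_iff {p : ℤ × ℤ} : p ∈ strip β b ↔ |(p.2 : ℝ) - β * p.1| ≤ b / 2 := by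
  rw [abs_le, neg_le_sub_iff_le_add, sub_le_iff_le_add', strip, Set.mem_ofPred_eq,
    sub_le_iff_le_add]

theorem exists_finite_strip_subset_add (β b' : ℝ) (hb : 0 < b) :
    ∃ N : Set (ℤ × ℤ), N.Finite ∧ strip β b' ⊆ N + strip β b := by
  let height : ℤ × ℤ → ℝ := fun p => p.2 - β * p.1
  have hbdd : TotallyBounded (height '' strip β b') :=
    (totallyBounded_Icc (-(b' / 2)) (b' / 2)).subset <| by
      rintro _ ⟨p, hp, rfl⟩
      exact abs_le.1 (mem_strip_iff.1 hp)
  obtain ⟨N, -, hN, hcover⟩ := Set.exists_subset_image_finite_and.1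
    (Metric.finite_approx_of_totallyBounded hbdd (b / 2) (half_pos hb))
  refine ⟨N, hN, fun p hp => ?_⟩
  obtain ⟨_, ⟨k, hk, rfl⟩, hpk⟩ := Set.mem_iUnion₂.1 (hcover (Set.mem_image_of_mem _ hp))
  refine ⟨k, hk, p - k, mem_strip_iff.2 ?_, add_sub_cancel k p⟩
  rw [Metric.mem_ball, Real.dist_eq] at hpk
  have hdiff : ((p - k).2 : ℝ) - β * (p - k).1 = height p - height k := by
    simp only [height, Prod.fst_sub, Prod.snd_sub, Int.cast_sub]
    ring
  exact hdiff ▸ hpk.le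

theorem almostPeriodic_strip_le (μ : Measure X) [VAddInvariantMeasure (ℤ × ℤ) X μ] (β b' : ℝ)
    (hb : 0 < b) : almostPeriodic μ (strip β b) ≤ almostPeriodic μ (strip β b') := by
  obtain ⟨N, hN, hsub⟩ := exists_finite_strip_subset_add β b' hb
  exact almostPeriodic_le_of_subset_add hN hsub

theorem IsWeakMixing.exists_ae_eq_const [IsProbabilityMeasure μ] (hμ : IsWeakMixing μ β b)
    (hb' : 0 < b') {f : Lp ℂ 2 μ} (hf : f ∈ almostPeriodic μ (strip β b')) :
    ∃ c : ℂ, f =ᵐ[μ] Function.const X c := by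
  refine exists_eventuallyEq_const_of_forall_separating IsClosed fun F hF => ?_
  have hm := (Lp.stronglyMeasurable f).measurable hF.measurableSet
  have hmem := (mem_kroneckerAlgebra_iff hm).2
    (indicatorL2_preimage_mem_almostPeriodic (almostPeriodic_strip_le μ β b hb' hf) hF)
  exact (hμ _ hmem).symm.imp eventuallyEq_univ.1 fun h => h.mem_iff.mono fun x hx => by
    simpa using hx

end Strip

section FactorMap

variable {X Y : Type*} [MeasurableSpace X] [AddAction (ℤ × ℤ) X] [MeasurableConstVAdd (ℤ × ℤ) X]
  [MeasurableSpace Y] [AddAction (ℤ × ℤ) Y] [MeasurableConstVAdd (ℤ × ℤ) Y]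
  {μ : Measure X} [VAddInvariantMeasure (ℤ × ℤ) X μ]
  {ν : Measure Y} [VAddInvariantMeasure (ℤ × ℤ) Y ν]

theorem compMeasurePreserving_mem_almostPeriodic {S : Set (ℤ × ℤ)} {π : X → Y}
    (hπ : MeasurePreserving π μ ν) (heq : ∀ (g : ℤ × ℤ) (x : X), π (g +ᵥ x) = g +ᵥ π x)
    {f : Lp ℂ 2 ν} (hf : f ∈ almostPeriodic ν S) :
    Lp.compMeasurePreserving π hπ f ∈ almostPeriodic μ S := by
  refine (hf.image (Lp.isometry_compMeasurePreserving hπ).uniformContinuous).subset ?_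
  rintro _ ⟨g, hg, rfl⟩
  refine ⟨_, ⟨g, hg, rfl⟩, ?_⟩
  have hcomm : π ∘ (g +ᵥ ·) = (g +ᵥ ·) ∘ π := funext (heq g)
  calc Lp.compMeasurePreserving π hπ (koopman ν g f)
      = Lp.compMeasurePreserving ((g +ᵥ ·) ∘ π) ((measurePreserving_vadd g ν).comp hπ) f :=
        (Lp.compMeasurePreserving_comp_apply f _ _).symm
    _ = Lp.compMeasurePreserving (π ∘ (g +ᵥ ·)) (hπ.comp (measurePreserving_vadd g μ)) f := by
        simp only [hcomm]
    _ = koopman μ g (Lp.compMeasurePreserving π hπ f) := Lp.compMeasurePreserving_comp_apply f _ _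

end FactorMap

section Multiplication

variable {Ω : Type*} [MeasurableSpace Ω] (P : Measure Ω) [IsFiniteMeasure P] {A E : Set Ω}

/-- Multiplication by the indicator function of `E` as an operator on `L²(P)`. -/
noncomputable def indicatorMul (hE : MeasurableSet E) : Lp ℂ 2 P →L[ℂ] Lp ℂ 2 P :=
  (ContinuousLinearMap.mul ℂ ℂ).holderL P ∞ 2 2 (indicatorConstLp ∞ hE (measure_ne_top P E) 1)

theorem norm_indicatorMul_le (hE : MeasurableSet E) : ‖indicatorMul P hE‖ ≤ 1 :=
  calc ‖indicatorMul P hE‖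
      ≤ ‖(ContinuousLinearMap.mul ℂ ℂ).holderL P ∞ 2 2‖ *
          ‖indicatorConstLp ∞ hE (measure_ne_top P E) (1 : ℂ)‖ := ContinuousLinearMap.le_opNorm _ _
    _ ≤ 1 * 1 := by
      gcongr
      · exact (ContinuousLinearMap.norm_holderL_le _).trans
          (ContinuousLinearMap.opNorm_mul_le ℂ ℂ)
      · exact norm_indicatorConstLp_le.trans_eq (by simp)
    _ = 1 := one_mul 1

theorem indicatorMul_indicatorL2 (hE : MeasurableSet E) (hA : MeasurableSet A) :
    indicatorMul P hE (indicatorL2 P hA) = indicatorL2 P (hA.inter hE) := by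
  refine Lp.ext ?_
  filter_upwards [(ContinuousLinearMap.mul ℂ ℂ).coeFn_holder (r := 2)
      (indicatorConstLp ∞ hE (measure_ne_top P E) 1) (indicatorL2 P hA),
    indicatorConstLp_coeFn (p := ∞) (hs := hE) (hμs := measure_ne_top P E) (c := (1 : ℂ)),
    coeFn_indicatorL2 P hA, coeFn_indicatorL2 P (hA.inter hE)] with x hmul h₁ h₂ h₃
  refine hmul.trans ?_
  rw [ContinuousLinearMap.mul_apply', h₁, h₂, h₃, Set.inter_comm A E,
    ← Set.inter_indicator_mul, one_mul]

end Multiplication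

section FiberIntegral

variable {X Y : Type*} [MeasurableSpace X] [MeasurableSpace Y] (μ : Measure X) (ν : Measure Y)
  [IsProbabilityMeasure μ] [IsProbabilityMeasure ν] {A : Set X} {C W : Set Y}

/-- Integration over `C` in the second variable, `Φ ↦ ∫_C Φ(·, y) dν(y)`, as an operator from
`L²(μ × ν)` to `L²(μ)`; it is encoded as the adjoint of `f ↦ ((x, y) ↦ f x * 1_C y)`. -/
noncomputable def fiberIntegral (hC : MeasurableSet C) :
    Lp ℂ 2 (μ.prod ν) →L[ℂ] Lp ℂ 2 μ :=
  (indicatorMul (μ.prod ν) (measurable_snd hC) ∘L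
    (Lp.compMeasurePreservingₗᵢ ℂ Prod.fst
      (measurePreserving_fst (μ := μ) (ν := ν))).toContinuousLinearMap).adjoint

theorem norm_fiberIntegral_le (hC : MeasurableSet C) : ‖fiberIntegral μ ν hC‖ ≤ 1 := by
  rw [fiberIntegral, LinearIsometryEquiv.norm_map]
  exact (ContinuousLinearMap.opNorm_comp_le _ _).trans (mul_le_one₀ (norm_indicatorMul_le _ _)
    (norm_nonneg _) (LinearIsometry.norm_toContinuousLinearMap_le _))

theorem uniformEquicontinuous_fiberIntegral :
    UniformEquicontinuous fun C : Subtype (MeasurableSet (α := Y)) => ⇑(fiberIntegral μ ν C.2) :=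
  LipschitzWith.uniformEquicontinuous _ 1 fun C =>
    ContinuousLinearMap.lipschitzWith_of_opNorm_le (norm_fiberIntegral_le μ ν C.2)

variable {μ ν}

theorem inner_indicatorL2_fiberIntegral (hA : MeasurableSet A) (hC : MeasurableSet C)
    (Φ : Lp ℂ 2 (μ.prod ν)) :
    inner ℂ (indicatorL2 μ hA) (fiberIntegral μ ν hC Φ) =
      inner ℂ (indicatorL2 (μ.prod ν) (hA.prod hC)) Φ := by
  rw [fiberIntegral, ContinuousLinearMap.adjoint_inner_right]
  exact congrArg (inner ℂ · Φ) (indicatorMul_indicatorL2 (μ.prod ν) _ (measurable_fst hA))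

theorem fiberIntegral_indicatorL2_prod (hA : MeasurableSet A) (hC : MeasurableSet C)
    (hW : MeasurableSet W) :
    fiberIntegral μ ν hW (indicatorL2 (μ.prod ν) (hA.prod hC)) =
      (ν.real (W ∩ C) : ℂ) • indicatorL2 μ hA := by
  refine ext_inner_indicatorL2 fun {A'} hA' => ?_
  rw [inner_indicatorL2_fiberIntegral, inner_smul_right,
    L2.inner_indicatorConstLp_one_indicatorConstLp_one,
    L2.inner_indicatorConstLp_one_indicatorConstLp_one, Set.prod_inter_prod, measureReal_prod_prod]
  push_cast
  exact mul_comm _ _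

theorem totallyBounded_range_fiberIntegral (Φ : Lp ℂ 2 (μ.prod ν)) :
    TotallyBounded (Set.range fun C : Subtype (MeasurableSet (α := Y)) =>
      fiberIntegral μ ν C.2 Φ) := by
  suffices htop : precompactOrbitSubmodule
      (fun C : Subtype (MeasurableSet (α := Y)) => fiberIntegral μ ν C.2) Set.univ = ⊤ by
    rw [← Set.image_univ, ← mem_precompactOrbitSubmodule, htop]
    exact Submodule.mem_top
  refine eq_top_of_indicatorL2_mem
    (isClosed_precompactOrbitSubmodule (uniformEquicontinuous_fiberIntegral μ ν) _)
    generateFrom_prod.symm isPiSystem_prod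
    ⟨Set.univ, MeasurableSet.univ, Set.univ, MeasurableSet.univ, Set.univ_prod_univ⟩ ?_
  rintro _ ⟨A, hA, C, hC, rfl⟩ _
  have hcont : Continuous fun r : ℝ => (r : ℂ) • indicatorL2 μ hA := by fun_prop
  refine ((isCompact_Icc (a := (0 : ℝ)) (b := 1)).image hcont).totallyBounded.subset ?_
  rintro _ ⟨W, -, rfl⟩
  exact ⟨ν.real (W ∩ C), ⟨measureReal_nonneg, measureReal_le_one⟩,
    (fiberIntegral_indicatorL2_prod hA hC W.2).symm⟩

end FiberIntegral

section Product

variable {X Y : Type*} [MeasurableSpace X] [AddAction (ℤ × ℤ) X] [MeasurableConstVAdd (ℤ × ℤ) X]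
  [MeasurableSpace Y] [AddAction (ℤ × ℤ) Y] [MeasurableConstVAdd (ℤ × ℤ) Y]
  {μ : Measure X} [IsProbabilityMeasure μ] [VAddInvariantMeasure (ℤ × ℤ) X μ]
  {ν : Measure Y} [IsProbabilityMeasure ν] [VAddInvariantMeasure (ℤ × ℤ) Y ν]
  {S : Set (ℤ × ℤ)} {A : Set X} {C : Set Y} {B : Set (X × Y)} {β b b₁ b₂ : ℝ}

theorem koopman_fiberIntegral (g : ℤ × ℤ) (hC : MeasurableSet C) (Φ : Lp ℂ 2 (μ.prod ν)) :
    koopman μ g (fiberIntegral μ ν hC Φ) =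
      fiberIntegral μ ν (measurable_const_vadd g hC) (koopman (μ.prod ν) g Φ) := by
  refine ext_inner_indicatorL2 fun {A} hA => ?_
  obtain ⟨A', hA', rfl⟩ : ∃ A', MeasurableSet A' ∧ (fun x : X => g +ᵥ x) ⁻¹' A' = A :=
    ⟨_, measurable_const_vadd (-g) hA, by ext x; simp⟩
  have hrect : koopman (μ.prod ν) g (indicatorL2 (μ.prod ν) (hA'.prod hC)) =
      indicatorL2 (μ.prod ν)
        ((measurable_const_vadd g hA').prod (measurable_const_vadd g hC)) :=
    koopman_indicatorL2 g _
  rw [inner_indicatorL2_fiberIntegral, ← koopman_indicatorL2 g hA', LinearIsometry.inner_map_map,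
    inner_indicatorL2_fiberIntegral, ← hrect, LinearIsometry.inner_map_map]

theorem fiberIntegral_mem_almostPeriodic (hC : MeasurableSet C) {Φ : Lp ℂ 2 (μ.prod ν)}
    (hΦ : Φ ∈ almostPeriodic (μ.prod ν) S) : fiberIntegral μ ν hC Φ ∈ almostPeriodic μ S := by
  refine (totallyBounded_image2 (S := Set.univ) (uniformEquicontinuous_fiberIntegral μ ν) hΦ
    fun Ψ _ => Set.image_univ ▸ totallyBounded_range_fiberIntegral Ψ).subset ?_
  rintro _ ⟨g, hg, rfl⟩
  exact ⟨⟨_, measurable_const_vadd g hC⟩, trivial, _, ⟨g, hg, rfl⟩,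
    (koopman_fiberIntegral g hC Φ).symm⟩

theorem IsWeakMixing.measureReal_inter_prod (hμ : IsWeakMixing μ β b₁) (hb : 0 < b)
    (hB : MeasurableSet B)
    (hBap : indicatorL2 (μ.prod ν) hB ∈ almostPeriodic (μ.prod ν) (strip β b))
    (hA : MeasurableSet A) (hC : MeasurableSet C) :
    (μ.prod ν).real (A ×ˢ C ∩ B) = μ.real A * (μ.prod ν).real (Set.univ ×ˢ C ∩ B) := by
  obtain ⟨c, hc⟩ := hμ.exists_ae_eq_const hb (fiberIntegral_mem_almostPeriodic hC hBap)
  have hfiber : ∀ {A : Set X}, MeasurableSet A →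
      ((μ.prod ν).real (A ×ˢ C ∩ B) : ℂ) = μ.real A * c := fun {A} hA =>
    calc ((μ.prod ν).real (A ×ˢ C ∩ B) : ℂ)
        = inner ℂ (indicatorL2 (μ.prod ν) (hA.prod hC)) (indicatorL2 (μ.prod ν) hB) :=
          (L2.inner_indicatorConstLp_one_indicatorConstLp_one _ _).symm
      _ = inner ℂ (indicatorL2 μ hA) (fiberIntegral μ ν hC (indicatorL2 (μ.prod ν) hB)) :=
          (inner_indicatorL2_fiberIntegral _ _ _).symm
      _ = ∫ x in A, fiberIntegral μ ν hC (indicatorL2 (μ.prod ν) hB) x ∂μ :=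
          L2.inner_indicatorConstLp_one _ _ _
      _ = ∫ _ in A, c ∂μ := integral_congr_ae (ae_restrict_of_ae hc)
      _ = μ.real A * c := by rw [setIntegral_const, Complex.real_smul]
  have huniv := hfiber MeasurableSet.univ
  rw [probReal_univ, Complex.ofReal_one, one_mul] at huniv
  exact_mod_cast huniv ▸ hfiber hA

theorem IsWeakMixing.measureReal_univ_prod_inter (hν : IsWeakMixing ν β b₂) (hb : 0 < b)
    (hB : MeasurableSet B)
    (hBap : indicatorL2 (μ.prod ν) hB ∈ almostPeriodic (μ.prod ν) (strip β b))
    (hC : MeasurableSet C) :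
    (μ.prod ν).real (Set.univ ×ˢ C ∩ B) = ν.real C * (μ.prod ν).real B := by
  have hswap : MeasurePreserving (Prod.swap : Y × X → X × Y) (ν.prod μ) (μ.prod ν) :=
    Measure.measurePreserving_swap
  have hBap' : indicatorL2 (ν.prod μ) (hswap.measurable hB) ∈
      almostPeriodic (ν.prod μ) (strip β b) :=
    compMeasurePreserving_mem_almostPeriodic hswap (fun _ _ => rfl) hBap
  have hpre : ∀ {C : Set Y}, MeasurableSet C →
      (ν.prod μ).real (C ×ˢ Set.univ ∩ Prod.swap ⁻¹' B) =
        (μ.prod ν).real (Set.univ ×ˢ C ∩ B) := fun {C} hC => by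
    rw [← hswap.measureReal_preimage ((MeasurableSet.univ.prod hC).inter hB).nullMeasurableSet,
      Set.preimage_inter, Set.preimage_swap_prod]
  have h := hν.measureReal_inter_prod hb (hswap.measurable hB) hBap' hC MeasurableSet.univ
  rwa [hpre hC, hpre MeasurableSet.univ, Set.univ_prod_univ, Set.univ_inter] at h

theorem IsWeakMixing.indepSets_rectangles (hμ : IsWeakMixing μ β b₁) (hν : IsWeakMixing ν β b₂)
    (hb : 0 < b) (hB : MeasurableSet B)
    (hBap : indicatorL2 (μ.prod ν) hB ∈ almostPeriodic (μ.prod ν) (strip β b)) :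
    IndepSets (Set.image2 (· ×ˢ ·) {A : Set X | MeasurableSet A} {C : Set Y | MeasurableSet C})
      {B} (μ.prod ν) := by
  refine (IndepSets_iff _ _ _).2 ?_
  rintro _ B ⟨A, hA, C, hC, rfl⟩ rfl
  have hreal : (μ.prod ν).real (A ×ˢ C ∩ B) = (μ.prod ν).real (A ×ˢ C) * (μ.prod ν).real B := by
    rw [hμ.measureReal_inter_prod hb hB hBap hA hC, hν.measureReal_univ_prod_inter hb hB hBap hC,
      measureReal_prod_prod, mul_assoc]
  simp only [measureReal_def, ← ENNReal.toReal_mul] at hreal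
  exact (ENNReal.toReal_eq_toReal_iff' (by finiteness) (by finiteness)).1 hreal

end Product

end DirectionalMixing

theorem mainTheorem7_general
    {X : Type*} [MeasurableSpace X] [AddAction (ℤ × ℤ) X] [MeasurableConstVAdd (ℤ × ℤ) X]
    {Y : Type*} [MeasurableSpace Y] [AddAction (ℤ × ℤ) Y] [MeasurableConstVAdd (ℤ × ℤ) Y]
    {μ : Measure X} [IsProbabilityMeasure μ] [VAddInvariantMeasure (ℤ × ℤ) X μ]
    {ν : Measure Y} [IsProbabilityMeasure ν] [VAddInvariantMeasure (ℤ × ℤ) Y ν]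
    {β b₁ b₂ b : ℝ} (hb : 0 < b) (hμ : DirectionalMixing.IsWeakMixing μ β b₁)
    (hν : DirectionalMixing.IsWeakMixing ν β b₂) :
    DirectionalMixing.IsWeakMixing (μ.prod ν) β b := by
  intro B hB
  have hBm : MeasurableSet B := hB.1
  have hBap := (DirectionalMixing.mem_kroneckerAlgebra_iff hBm).1 hB
  exact DirectionalMixing.ae_eq_empty_or_univ_of_indepSets generateFrom_prod.symm isPiSystem_prod
    hBm (hμ.indepSets_rectangles hν hb hBm hBap)

theorem mainTheorem7
    {X₁ : Type*} [MetricSpace X₁] [CompactSpace X₁] [MeasurableSpace X₁] [BorelSpace X₁]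
    [AddAction (ℤ × ℤ) X₁] [ContinuousConstVAdd (ℤ × ℤ) X₁]
    {X₂ : Type*} [MetricSpace X₂] [CompactSpace X₂] [MeasurableSpace X₂] [BorelSpace X₂]
    [AddAction (ℤ × ℤ) X₂] [ContinuousConstVAdd (ℤ × ℤ) X₂]
    (μ : MeasureTheory.Measure X₁) [MeasureTheory.IsProbabilityMeasure μ]
    [MeasureTheory.VAddInvariantMeasure (ℤ × ℤ) X₁ μ]
    (ν : MeasureTheory.Measure X₂) [MeasureTheory.IsProbabilityMeasure ν]
    [MeasureTheory.VAddInvariantMeasure (ℤ × ℤ) X₂ ν]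
    (β b₁ b₂ b : ℝ) (hb₁ : 0 < b₁) (hb₂ : 0 < b₂) (hb : 0 < b)
    (hμ : DirectionalMixing.IsWeakMixing μ β b₁) (hν : DirectionalMixing.IsWeakMixing ν β b₂) :
    DirectionalMixing.IsWeakMixing (μ.prod ν) β b := by
  exact mainTheorem7_general hb hμ hν
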